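/- Let $G$ be a topological group with identity $e$ (locally compact and second countable), with a left-invariant metric $d$ that is proper (closed bounded sets are compact) and induces the topology of $G$, and let $\lambda$ be a left Haar measure on $G$. Assume that $(G,d)$ is geodesic and has finite asymptotic dimension in the following sense: there is an integer $N>0$ such that for every $r>0$ there is a countable covering $\{F_j\}$ of $G$ by disjoint Borel sets such that every point of $G$ belongs to at most $N$ of the sets $\{x: d(x,F_j)\le r\}$, and there is $K>0$ with $\operatorname{diam}F_j\le Kr$ for all $j$. (The space $(G,d,\lambda)$ is then automatically complete, and $\sup_{x}\lambda(D(x,r))<\infty$ for each $r>0$, where $D(x,r)$ is the ball with centre $x$ and radius $r$.) Let $\mathcal H$ be a separable complex Hilbert space and let $\mathcal F=\{f_x\}_{x\in G}$ be a continuous frame in $\mathcal H$: the map $x\mapsto f_x$ is bounded and continuous, and there are constants $c,C>0$ with $$c\|h\|^2\le\int_G|\langle h,f_x\rangle|^2\,d\lambda(x)\le C\|h\|^2\qquad\text{for all }h\in\mathcal H .$$ Let $Sh=\int_G\langle h,f_x\rangle f_x\,d\lambda(x)$ (weak integral) be the frame operator and $\tilde{\mathcal F}=\{\tilde f_x\}_{x\in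 G}$, $\tilde f_x=S^{-1}f_x$, the canonical dual frame. Assume that $$\langle\tilde f_x,f_y\rangle=\langle\tilde f_{zx},f_{zy}\rangle\qquad\text{for all }x,y,z\in G .$$ For a bounded operator $T$ on $\mathcal H$ let $B(T)(x)=\langle T\tilde f_x,f_x\rangle$ be its Berezin transform, and assume that $B:\mathcal B(\mathcal H)\to C(G)$ is injective. Let $T$ be a bounded linear operator on $\mathcal H$ that is weakly localized with respect to $(\tilde{\mathcal F},\mathcal F)$, i.e. for some measurable $p:G\to(0,\infty)$ there is a constant $A$ such that $$\int_G|\langle T\tilde f_x,f_y\rangle|\,p(y)\,d\lambda(y)\le A\,p(x)\ \ (x\in G),\qquad \int_G|\langle T\tilde f_x,f_y\rangle|\,p(x)\,d\lambda(x)\le A\,p(y)\ \ (y\in G),$$ and $$\lim_{R\to\infty}\sup_{x\in G}\frac1{p(x)}\int_{D(x,R)^c}|\langle T\tilde f_x,f_y\rangle|\,p(y)\,d\lambda(y)=0,\qquad \lim_{R\to\infty}\sup_{y\in G}\frac1{p(y)}\int_{D(y,R)^c}|\langle T\tilde f_x,f_y\rangle|\,p(x)\,d\lambda(x)=0 .$$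 Then $T$ is compact if and only if $\lim_{d(x,e)\to\infty}B(T)(x)=0$. (If $G$ is bounded, the limit condition holds vacuously.) -/

import Mathlib

open MeasureTheory Filter Topology
open scoped ENNReal NNReal

noncomputable section

/-- A geodesic metric space: any two points are the end points of an isometrically embedded
segment of length their distance. -/
def IsGeodesicSpace (X : Type*) [MetricSpace X] : Prop :=
  ∀ x y : X, ∃ γ : ℝ → X, γ 0 = x ∧ γ (dist x y) = y ∧
    ∀ s ∈ Set.Icc 0 (dist x y), ∀ t ∈ Set.Icc 0 (dist x y), dist (γ s) (γ t) = |s - t|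

/-- Finite asymptotic dimension: for some `N`, at every scale `r > 0` there is a covering by
disjoint Borel sets of diameter at most `K r`, such that every point lies in the closed
`r`-neighbourhoods of at most `N` of them. The covering is enumerated by `ℕ`; the empty set may
be repeated, and its neighbourhood is empty, since `Metric.infEDist x ∅ = ∞`. -/
def HasFiniteAsymptoticDimension (X : Type*) [MetricSpace X] [MeasurableSpace X] : Prop :=
  ∃ N : ℕ, 0 < N ∧ ∀ r : ℝ, 0 < r → ∃ F : ℕ → Set X,
    (∀ j, MeasurableSet (F j)) ∧
    Pairwise (fun i j => Disjoint (F i) (F j)) ∧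
    (⋃ j, F j) = Set.univ ∧
    (∀ x : X, {j | Metric.infEDist x (F j) ≤ ENNReal.ofReal r}.encard ≤ N) ∧
    ∃ K : ℝ, 0 < K ∧ ∀ j, ∀ x ∈ F j, ∀ y ∈ F j, dist x y ≤ K * r

/-- The pair of families `(f, g)` is `p`-weakly localized. The inner product of Mathlib is
conjugate linear in its first argument, so `inner ℂ (g y) (f x)` is `⟨f_x, g_y⟩`; the integrals
and suprema take values in `[0, ∞]`. -/
structure IsPWeaklyLocalizedPair {X H : Type*} [MetricSpace X] [MeasurableSpace X]
    [NormedAddCommGroup H] [InnerProductSpace ℂ H]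
    (μ : Measure X) (p : X → ℝ) (f g : X → H) : Prop where
  bound_left : ∃ C : ℝ, ∀ x,
    ∫⁻ y, ‖inner ℂ (g y) (f x)‖ₑ * ENNReal.ofReal (p y) ∂μ ≤ ENNReal.ofReal (C * p x)
  bound_right : ∃ C : ℝ, ∀ y,
    ∫⁻ x, ‖inner ℂ (g y) (f x)‖ₑ * ENNReal.ofReal (p x) ∂μ ≤ ENNReal.ofReal (C * p y)
  tail_left : Tendsto
    (fun R : ℝ => ⨆ x, (∫⁻ y in (Metric.ball x R)ᶜ,
      ‖inner ℂ (g y) (f x)‖ₑ * ENNReal.ofReal (p y) ∂μ) / ENNReal.ofReal (p x))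
    atTop (𝓝 0)
  tail_right : Tendsto
    (fun R : ℝ => ⨆ y, (∫⁻ x in (Metric.ball y R)ᶜ,
      ‖inner ℂ (g y) (f x)‖ₑ * ENNReal.ofReal (p x) ∂μ) / ENNReal.ofReal (p y))
    atTop (𝓝 0)

/-- The operator `T` is weakly localized with respect to the pair of families `(f, g)`: for some
positive measurable weight `p` the pair `(T f, g)` is `p`-weakly localized. -/
def IsWeaklyLocalizedOperator {X H : Type*} [MetricSpace X] [MeasurableSpace X]
    [NormedAddCommGroup H] [InnerProductSpace ℂ H]
    (μ : Measure X) (f g : X → H) (T : H →L[ℂ] H) : Prop :=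
  ∃ p : X → ℝ, Measurable p ∧ (∀ x, 0 < p x) ∧
    IsPWeaklyLocalizedPair μ p (fun x => T (f x)) g

/-- A continuous frame in `H` indexed by the metric measure space `(X, μ)`. -/
structure ContinuousFrame (X H : Type*) [MetricSpace X] [MeasurableSpace X]
    [NormedAddCommGroup H] [InnerProductSpace ℂ H] (μ : Measure X) where
  /-- the vectors of the frame -/
  vec : X → H
  continuous_vec : Continuous vec
  bounded_vec : ∃ M : ℝ, ∀ x, ‖vec x‖ ≤ M
  lower_bound : ∃ c : ℝ, 0 < c ∧ ∀ h : H,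
    ENNReal.ofReal (c * ‖h‖ ^ 2) ≤ ∫⁻ x, ‖inner ℂ (vec x) h‖ₑ ^ 2 ∂μ
  upper_bound : ∃ C : ℝ, 0 < C ∧ ∀ h : H,
    ∫⁻ x, ‖inner ℂ (vec x) h‖ₑ ^ 2 ∂μ ≤ ENNReal.ofReal (C * ‖h‖ ^ 2)

namespace ContinuousFrame

variable {X H : Type*} [MetricSpace X] [MeasurableSpace X]
  [NormedAddCommGroup H] [InnerProductSpace ℂ H] {μ : Measure X}

theorem eLpNorm_coeff (F : ContinuousFrame X H μ) (h : H) :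
    eLpNorm (fun x => inner ℂ (F.vec x) h) 2 μ ^ 2 = ∫⁻ x, ‖inner ℂ (F.vec x) h‖ₑ ^ 2 ∂μ := by
  rw [eLpNorm_eq_lintegral_rpow_enorm_toReal (by norm_num) (by norm_num), ← ENNReal.rpow_natCast,
    ← ENNReal.rpow_mul]
  norm_num

variable [BorelSpace X]

theorem memLp_coeff (F : ContinuousFrame X H μ) (h : H) :
    MemLp (fun x => inner ℂ (F.vec x) h) 2 μ := by
  obtain ⟨C, -, hC⟩ := F.upper_bound
  refine ⟨(F.continuous_vec.inner continuous_const).aestronglyMeasurable, ?_⟩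
  have h2 : eLpNorm (fun x => inner ℂ (F.vec x) h) 2 μ ^ 2 < ∞ := by
    rw [F.eLpNorm_coeff]
    exact (hC h).trans_lt ENNReal.ofReal_lt_top
  exact lt_top_iff_ne_top.2 fun h0 => by simp [h0] at h2

theorem ofReal_norm_toLp_sq (F : ContinuousFrame X H μ) (h : H) :
    ENNReal.ofReal (‖(F.memLp_coeff h).toLp‖ ^ 2) = ∫⁻ x, ‖inner ℂ (F.vec x) h‖ₑ ^ 2 ∂μ := by
  rw [← F.eLpNorm_coeff, Lp.norm_toLp, ENNReal.ofReal_pow ENNReal.toReal_nonneg,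
    ENNReal.ofReal_toReal (F.memLp_coeff h).2.ne]

/-- The analysis operator `h ↦ (x ↦ ⟨h, f_x⟩)` from `H` to `L²(X, μ)`. -/
def analysis (F : ContinuousFrame X H μ) : H →L[ℂ] Lp ℂ 2 μ :=
  LinearMap.mkContinuousOfExistsBound
    { toFun := fun h => (F.memLp_coeff h).toLp
      map_add' := fun h k => by
        rw [← MemLp.toLp_add]
        exact MemLp.toLp_congr _ _ (Eventually.of_forall fun x => by simp)
      map_smul' := fun a h => by
        rw [RingHom.id_apply, ← MemLp.toLp_const_smul]
        exact MemLp.toLp_congr _ _ (Eventually.of_forall fun x => by simp) }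
    (by
      obtain ⟨C, hC0, hC⟩ := F.upper_bound
      refine ⟨√C, fun h => ?_⟩
      have h1 := hC h
      rw [← F.ofReal_norm_toLp_sq, ENNReal.ofReal_le_ofReal_iff (by positivity)] at h1
      refine abs_le_of_sq_le_sq' ?_ (by positivity) |>.2
      rw [mul_pow, Real.sq_sqrt hC0.le]
      exact h1)

/-- The analysis operator is given almost everywhere by the frame coefficients. -/
theorem coeFn_analysis (F : ContinuousFrame X H μ) (h : H) :
    F.analysis h =ᵐ[μ] fun x => inner ℂ (F.vec x) h :=
  (F.memLp_coeff h).coeFn_toLp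

variable [CompleteSpace H]

/-- The synthesis operator `a ↦ ∫ a(x) f_x dμ(x)` (weak integral), the adjoint of the analysis
operator. -/
def synthesis (F : ContinuousFrame X H μ) : Lp ℂ 2 μ →L[ℂ] H :=
  ContinuousLinearMap.adjoint F.analysis

/-- The frame operator `h ↦ ∫ ⟨h, f_x⟩ f_x dμ(x)`. -/
def frameOperator (F : ContinuousFrame X H μ) : H →L[ℂ] H :=
  F.synthesis ∘L F.analysis

/-- The frame operator is invertible, so that its inverse is not a junk value below. -/
theorem isUnit_frameOperator (F : ContinuousFrame X H μ) : IsUnit F.frameOperator := by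
  obtain ⟨c, hc0, hc⟩ := F.lower_bound
  refine ContinuousLinearMap.isUnit_of_forall_le_norm_inner_map _ (c := ⟨c, hc0.le⟩) hc0
    fun h => ?_
  have h1 := hc h
  rw [← F.ofReal_norm_toLp_sq, ENNReal.ofReal_le_ofReal_iff (by positivity)] at h1
  have h2 : inner ℂ (F.frameOperator h) h = ((‖F.analysis h‖ ^ 2 : ℝ) : ℂ) := by
    rw [frameOperator, ContinuousLinearMap.comp_apply, synthesis,
      ContinuousLinearMap.adjoint_inner_left, inner_self_eq_norm_sq_to_K]
    norm_cast
  rw [h2, Complex.norm_real, Real.norm_of_nonneg (by positivity), mul_comm]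
  exact h1

/-- The canonical dual frame `f̃_x = S⁻¹ f_x`, where `S` is the frame operator. -/
def dual (F : ContinuousFrame X H μ) (x : X) : H :=
  Ring.inverse F.frameOperator (F.vec x)

theorem frameOperator_dual (F : ContinuousFrame X H μ) (x : X) :
    F.frameOperator (F.dual x) = F.vec x :=
  congrArg (fun A : H →L[ℂ] H => A (F.vec x))
    (Ring.mul_inverse_cancel _ F.isUnit_frameOperator)

/-- The Berezin transform `B(T)(x) = ⟨T f̃_x, f_x⟩`, a map from the bounded operators on `H` to
the continuous functions on `X`. -/
def berezin (F : ContinuousFrame X H μ) (T : H →L[ℂ] H) : C(X, ℂ) where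
  toFun x := inner ℂ (F.vec x) (T (F.dual x))
  continuous_toFun :=
    F.continuous_vec.inner
      (T.continuous.comp ((Ring.inverse F.frameOperator).continuous.comp F.continuous_vec))

/-- Invariance of the inner products under left translation:
`⟨f̃_x, f_y⟩ = ⟨f̃_{zx}, f_{zy}⟩` for all `x, y, z` in the group. -/
def IsTranslationInvariant {G : Type*} [Group G] [MetricSpace G] [MeasurableSpace G]
    [BorelSpace G] {μ : Measure G} (F : ContinuousFrame G H μ) : Prop :=
  ∀ x y z : G, inner ℂ (F.vec y) (F.dual x) = inner ℂ (F.vec (z * y)) (F.dual (z * x))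

end ContinuousFrame

end

/-!
The matrix of `T` is the kernel `k(x, y) = ⟨T f̃_x, f_y⟩`; the reproducing formula
`h = ∫ ⟨h, f_x⟩ f̃_x dμ(x)` makes it act on frame coefficients by
`⟨T h, f_y⟩ = ∫ k(x, y) ⟨h, f_x⟩ dμ(x)`. Invariance of the reproducing kernel `⟨f̃_x, f_y⟩` gives
uniformly bounded operators that take `f̃_x` to `f̃_{zx}` and `f_y` to `f_{zy}`
(`ContinuousFrame.translation` and its composition with the inverse of the frame operator), so that
every translate `k(zx, zy)` of the matrix is the matrix of an operator, with a bound on the norm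
that does not depend on `z` (`ContinuousFrame.exists_translates`).

Suppose that `B(T)` vanishes at infinity. If `k(x, y)` did not tend to `0` as `x → ∞`, uniformly
on `d(x, y) < R`, then a weak limit of translates of `T` would be nonzero, while its Berezin
transform vanishes; this contradicts the injectivity of `B`
(`ContinuousFrame.exists_norm_matrix_le`). Now let `P` be the part of the reproducing formula over
a large ball, a compact operator (`ContinuousFrame.isCompactOperator_truncation`). The operator
`T - T P` has the matrix of `T` with the columns `x` of that ball removed. Far from the diagonal it
is small by weak localization and the Schur test with the weight `p`; at distance less than `R`
from the diagonal its entries are uniformly small, and the Schur test with the weight `1` applies,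
since all balls of radius `R` have the same finite measure. So `T` is a norm limit of the compact
operators `T P`.

Conversely, the frame vectors tend weakly to `0` at infinity (`ContinuousFrame.tendsto_inner_vec`):
their coefficients against a fixed vector are square integrable and uniformly continuous. Weak
convergence to `0` is uniform on the relatively compact set of the vectors `T f̃_x` when `T` is
compact, whence `B(T)(x) = ⟨T f̃_x, f_x⟩ → 0`.
-/

/-! ### The Schur test -/

/-- The Cauchy–Schwarz inequality for `[0, ∞]`-valued functions, squared. -/
theorem sq_lintegral_mul_le {X : Type*} [MeasurableSpace X] (μ : Measure X) {f g : X → ℝ≥0∞}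
    (hf : AEMeasurable f μ) (hg : AEMeasurable g μ) :
    (∫⁻ x, f x * g x ∂μ) ^ 2 ≤ (∫⁻ x, f x ^ 2 ∂μ) * ∫⁻ x, g x ^ 2 ∂μ := by
  have h := ENNReal.lintegral_mul_le_Lp_mul_Lq μ Real.HolderConjugate.two_two hf hg
  simp only [Pi.mul_apply, ENNReal.rpow_ofNat] at h
  calc (∫⁻ x, f x * g x ∂μ) ^ 2
      ≤ ((∫⁻ x, f x ^ 2 ∂μ) ^ (1 / 2 : ℝ) * (∫⁻ x, g x ^ 2 ∂μ) ^ (1 / 2 : ℝ)) ^ 2 := by gcongr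
    _ = _ := by
      rw [mul_pow, ← ENNReal.rpow_ofNat, ← ENNReal.rpow_ofNat, ← ENNReal.rpow_mul,
        ← ENNReal.rpow_mul]
      norm_num

/-- **Schur test** with a weight `p`: both marginals of the kernel `κ` being dominated by `p`, the
integral operator with kernel `κ` is bounded on `L²`. -/
theorem lintegral_sq_lintegral_le_of_schur {X : Type*} [MeasurableSpace X] {μ : Measure X}
    [SFinite μ] {κ : X → X → ℝ≥0∞} (hκ : Measurable (Function.uncurry κ)) {p g : X → ℝ≥0∞}
    (hp : Measurable p) (hg : Measurable g) (hp0 : ∀ x, p x ≠ 0) (hp_top : ∀ x, p x ≠ ∞)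
    {A B : ℝ≥0∞} (hA : ∀ x, ∫⁻ y, κ x y * p y ∂μ ≤ A * p x)
    (hB : ∀ y, ∫⁻ x, κ x y * p x ∂μ ≤ B * p y) :
    ∫⁻ y, (∫⁻ x, κ x y * g x ∂μ) ^ 2 ∂μ ≤ A * B * ∫⁻ x, g x ^ 2 ∂μ := by
  have hκ₁ : ∀ y, Measurable fun x => κ x y := fun y => hκ.comp measurable_prodMk_right
  have hpoint : ∀ y, (∫⁻ x, κ x y * g x ∂μ) ^ 2
      ≤ B * p y * ∫⁻ x, κ x y * (p x)⁻¹ * g x ^ 2 ∂μ := by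
    intro y
    -- the factors to which the Cauchy–Schwarz inequality is applied
    have h1 : ∀ x, κ x y * g x
        = (κ x y * p x) ^ (1 / 2 : ℝ) * ((κ x y * (p x)⁻¹) ^ (1 / 2 : ℝ) * g x) := by
      intro x
      rw [← mul_assoc, ← ENNReal.mul_rpow_of_nonneg _ _ (by norm_num),
        mul_mul_mul_comm, ENNReal.mul_inv_cancel (hp0 x) (hp_top x), mul_one, ← sq,
        ← ENNReal.rpow_ofNat, ← ENNReal.rpow_mul]
      norm_num
    have h2 : ∀ a : ℝ≥0∞, (a ^ (1 / 2 : ℝ)) ^ 2 = a := fun a => by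
      rw [← ENNReal.rpow_ofNat, ← ENNReal.rpow_mul]
      norm_num
    calc (∫⁻ x, κ x y * g x ∂μ) ^ 2
        = (∫⁻ x, (κ x y * p x) ^ (1 / 2 : ℝ)
            * ((κ x y * (p x)⁻¹) ^ (1 / 2 : ℝ) * g x) ∂μ) ^ 2 := by simp_rw [h1]
      _ ≤ (∫⁻ x, κ x y * p x ∂μ) * ∫⁻ x, κ x y * (p x)⁻¹ * g x ^ 2 ∂μ := by
        have hm₁ : Measurable fun x => (κ x y * p x) ^ (1 / 2 : ℝ) :=
          ((hκ₁ y).mul hp).pow_const _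
        have hm₂ : Measurable fun x => (κ x y * (p x)⁻¹) ^ (1 / 2 : ℝ) * g x :=
          (((hκ₁ y).mul hp.inv).pow_const _).mul hg
        refine (sq_lintegral_mul_le μ hm₁.aemeasurable hm₂.aemeasurable).trans_eq ?_
        simp_rw [mul_pow, h2]
      _ ≤ _ := by gcongr; exact hB y
  calc ∫⁻ y, (∫⁻ x, κ x y * g x ∂μ) ^ 2 ∂μ
      ≤ ∫⁻ y, B * (∫⁻ x, p y * (κ x y * (p x)⁻¹ * g x ^ 2) ∂μ) ∂μ := by
        refine lintegral_mono fun y => (hpoint y).trans_eq ?_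
        have hm : Measurable fun x => κ x y * (p x)⁻¹ * g x ^ 2 :=
          ((hκ₁ y).mul hp.inv).mul (hg.pow_const 2)
        rw [lintegral_const_mul _ hm, mul_assoc]
    _ = B * ∫⁻ x, ∫⁻ y, p y * (κ x y * (p x)⁻¹ * g x ^ 2) ∂μ ∂μ := by
        have hm : Measurable fun q : X × X =>
            p q.1 * (κ q.2 q.1 * (p q.2)⁻¹ * g q.2 ^ 2) :=
          (hp.comp measurable_fst).mul ((((hκ.comp measurable_swap)).mul
            (hp.comp measurable_snd).inv).mul ((hg.comp measurable_snd).pow_const 2))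
        rw [lintegral_const_mul _ hm.lintegral_prod_right',
          lintegral_lintegral_swap hm.aemeasurable]
    _ ≤ B * ∫⁻ x, A * g x ^ 2 ∂μ := by
        gcongr with x
        have hm : Measurable fun y => κ x y * p y := (hκ.comp measurable_prodMk_left).mul hp
        calc ∫⁻ y, p y * (κ x y * (p x)⁻¹ * g x ^ 2) ∂μ
            = (∫⁻ y, κ x y * p y ∂μ) * ((p x)⁻¹ * g x ^ 2) := by
              rw [← lintegral_mul_const _ hm]
              exact lintegral_congr fun y => by ring
          _ ≤ A * p x * ((p x)⁻¹ * g x ^ 2) := by gcongr; exact hA x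
          _ = A * (p x * (p x)⁻¹) * g x ^ 2 := by ring
          _ = A * g x ^ 2 := by rw [ENNReal.mul_inv_cancel (hp0 x) (hp_top x), mul_one]
    _ = A * B * ∫⁻ x, g x ^ 2 ∂μ := by
        rw [lintegral_const_mul _ (hg.pow_const 2)]
        ring

/-! ### Weak limits of bounded families of operators -/

/-- A norm-bounded family of operators has a limit in the weak operator topology along every
ultrafilter. -/
theorem exists_weak_operator_limit {ι H : Type*} [NormedAddCommGroup H] [InnerProductSpace ℂ H]
    [CompleteSpace H] (𝒰 : Ultrafilter ι) {A : ι → H →L[ℂ] H} {M : ℝ} (hM : ∀ i, ‖A i‖ ≤ M) :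
    ∃ A₀ : H →L[ℂ] H, ∀ g h, Tendsto (fun i => inner ℂ g (A i h)) 𝒰 (𝓝 (inner ℂ g (A₀ h))) := by
  have hb : ∀ h g i, ‖inner ℂ (A i h) g‖ ≤ M * ‖h‖ * ‖g‖ := fun h g i =>
    (norm_inner_le_norm _ _).trans <| by
      gcongr
      exact ((A i).le_opNorm h).trans (by gcongr; exact hM i)
  have hlim : ∀ h g, ∃ b ∈ Metric.closedBall (0 : ℂ) (M * ‖h‖ * ‖g‖),
      Tendsto (fun i => inner ℂ (A i h) g) 𝒰 (𝓝 b) := by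
    intro h g
    obtain ⟨b, hb1, hb2⟩ := (isCompact_closedBall (0 : ℂ) (M * ‖h‖ * ‖g‖)).ultrafilter_le_nhds
      (𝒰.map fun i => inner ℂ (A i h) g)
      (le_principal_iff.2 (Filter.mem_map.2 (Eventually.of_forall fun i => by
        simpa using hb h g i)))
    exact ⟨b, hb1, hb2⟩
  choose b hb1 hb2 using hlim
  let B : H →L⋆[ℂ] H →L[ℂ] ℂ := LinearMap.mkContinuous₂
    (LinearMap.mk₂'ₛₗ (starRingEnd ℂ) (RingHom.id ℂ) b
      (fun h h' g => tendsto_nhds_unique (hb2 (h + h') g) <|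
        ((hb2 h g).add (hb2 h' g)).congr fun i => by rw [map_add, inner_add_left])
      (fun a h g => tendsto_nhds_unique (hb2 (a • h) g) <|
        ((hb2 h g).const_mul _).congr fun i => by rw [map_smul, inner_smul_left])
      (fun h g g' => tendsto_nhds_unique (hb2 h (g + g')) <|
        ((hb2 h g).add (hb2 h g')).congr fun i => by rw [inner_add_right])
      (fun a h g => tendsto_nhds_unique (hb2 h (a • g)) <|
        ((hb2 h g).const_mul _).congr fun i => by rw [inner_smul_right, RingHom.id_apply]))
    M (fun h g => by simpa using hb1 h g)
  -- `B` is conjugate linear in its first argument, so it represents `⟨A h, g⟩`, not `⟨g, A h⟩`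
  refine ⟨InnerProductSpace.continuousLinearMapOfBilin B, fun g h => ?_⟩
  have h1 : Tendsto (fun i => starRingEnd ℂ (inner ℂ (A i h) g)) 𝒰 (𝓝 (starRingEnd ℂ (b h g))) :=
    (Complex.continuous_conj.tendsto _).comp (hb2 h g)
  have h2 : inner ℂ g (InnerProductSpace.continuousLinearMapOfBilin B h)
      = starRingEnd ℂ (b h g) := by
    rw [← inner_conj_symm, InnerProductSpace.continuousLinearMapOfBilin_apply]
    rfl
  rw [h2]
  exact h1.congr fun i => inner_conj_symm _ _

namespace ContinuousFrame

section Frame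

variable {X H : Type*} [MetricSpace X] [MeasurableSpace X] [BorelSpace X]
  [NormedAddCommGroup H] [InnerProductSpace ℂ H] [CompleteSpace H] {μ : Measure X}

/-! ### The reproducing formula -/

theorem inner_frameOperator_left (F : ContinuousFrame X H μ) (g h : H) :
    inner ℂ (F.frameOperator g) h = inner ℂ (F.analysis g) (F.analysis h) := by
  rw [frameOperator, ContinuousLinearMap.comp_apply, synthesis,
    ContinuousLinearMap.adjoint_inner_left]

theorem inner_frameOperator_right (F : ContinuousFrame X H μ) (g h : H) :
    inner ℂ g (F.frameOperator h) = inner ℂ (F.frameOperator g) h := by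
  rw [inner_frameOperator_left, frameOperator, ContinuousLinearMap.comp_apply, synthesis,
    ContinuousLinearMap.adjoint_inner_right]

theorem frameOperator_inverse (F : ContinuousFrame X H μ) (h : H) :
    F.frameOperator (Ring.inverse F.frameOperator h) = h :=
  congrArg (fun A : H →L[ℂ] H => A h) (Ring.mul_inverse_cancel _ F.isUnit_frameOperator)

theorem inner_inverse_left (F : ContinuousFrame X H μ) (g h : H) :
    inner ℂ (Ring.inverse F.frameOperator g) h = inner ℂ g (Ring.inverse F.frameOperator h) := by
  conv_lhs => rw [← F.frameOperator_inverse h]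
  rw [inner_frameOperator_right, frameOperator_inverse]

theorem continuous_dual (F : ContinuousFrame X H μ) : Continuous F.dual :=
  (Ring.inverse F.frameOperator).continuous.comp F.continuous_vec

theorem bounded_dual (F : ContinuousFrame X H μ) : ∃ M : ℝ, ∀ x, ‖F.dual x‖ ≤ M := by
  obtain ⟨M, hM⟩ := F.bounded_vec
  exact ⟨‖Ring.inverse F.frameOperator‖ * M, fun x =>
    ((Ring.inverse F.frameOperator).le_opNorm _).trans (by gcongr; exact hM x)⟩

theorem inner_analysis_inverse_ae (F : ContinuousFrame X H μ) (g h : H) :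
    (fun x => inner ℂ (F.analysis (Ring.inverse F.frameOperator g) x) (F.analysis h x))
      =ᵐ[μ] fun x => inner ℂ g (F.dual x) * inner ℂ (F.vec x) h := by
  filter_upwards [F.coeFn_analysis (Ring.inverse F.frameOperator g), F.coeFn_analysis h]
    with x h1 h2
  rw [h1, h2, RCLike.inner_apply, inner_conj_symm, inner_inverse_left, mul_comm]
  rfl

theorem integrable_inner_dual_mul (F : ContinuousFrame X H μ) (g h : H) :
    Integrable (fun x => inner ℂ g (F.dual x) * inner ℂ (F.vec x) h) μ :=
  (L2.integrable_inner (𝕜 := ℂ) _ _).congr (F.inner_analysis_inverse_ae g h)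

/-- The reproducing formula `h = ∫ ⟨h, f_x⟩ f̃_x dμ(x)`, read weakly. -/
theorem inner_eq_integral (F : ContinuousFrame X H μ) (g h : H) :
    inner ℂ g h = ∫ x, inner ℂ g (F.dual x) * inner ℂ (F.vec x) h ∂μ := by
  rw [← integral_congr_ae (F.inner_analysis_inverse_ae g h), ← L2.inner_def,
    ← inner_frameOperator_left, frameOperator_inverse]

/-! ### Truncated synthesis of the reproducing formula -/

theorem continuous_rankOne_dual_vec (F : ContinuousFrame X H μ) :
    Continuous fun x => InnerProductSpace.rankOne ℂ (F.dual x) (F.vec x) :=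
  ((ContinuousLinearMap.smulRightL ℂ H H).continuous.comp
    ((innerSL ℂ).continuous.comp F.continuous_vec)).clm_apply F.continuous_dual

variable [ProperSpace X] [IsFiniteMeasureOnCompacts μ]

/-- The reproducing formula restricted to a set: `h ↦ ∫_s ⟨h, f_x⟩ f̃_x dμ(x)`, as a Bochner
integral of operators of rank one. It may be a junk value if `s` is unbounded. -/
noncomputable def truncation (F : ContinuousFrame X H μ) (s : Set X) : H →L[ℂ] H :=
  ∫ x in s, InnerProductSpace.rankOne ℂ (F.dual x) (F.vec x) ∂μ

theorem integrableOn_rankOne_dual_vec (F : ContinuousFrame X H μ) {s : Set X}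
    (hs : Bornology.IsBounded s) :
    IntegrableOn (fun x => InnerProductSpace.rankOne ℂ (F.dual x) (F.vec x)) s μ :=
  (F.continuous_rankOne_dual_vec.continuousOn.integrableOn_compact hs.isCompact_closure).mono_set
    subset_closure

theorem inner_truncation (F : ContinuousFrame X H μ) {s : Set X} (hs : Bornology.IsBounded s)
    (g h : H) :
    inner ℂ g (F.truncation s h) = ∫ x in s, inner ℂ g (F.dual x) * inner ℂ (F.vec x) h ∂μ := by
  have hi := F.integrableOn_rankOne_dual_vec hs
  rw [truncation, ContinuousLinearMap.integral_apply hi,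
    ← integral_inner (hi.apply_continuousLinearMap h)]
  exact integral_congr_ae (Eventually.of_forall fun x => by simp [inner_smul_right, mul_comm])

/-- A truncation to a bounded set is compact: it is the integral of a function with values in the
closed subspace of the compact operators. -/
theorem isCompactOperator_truncation (F : ContinuousFrame X H μ) {s : Set X}
    (hs : Bornology.IsBounded s) : IsCompactOperator (F.truncation s) := by
  let K : Submodule ℂ (H →L[ℂ] H) := compactOperator (RingHom.id ℂ) H H
  have hK : IsClosed (K : Set (H →L[ℂ] H)) := isClosed_setOfPred_isCompactOperator
  have : CompleteSpace K := hK.completeSpace_coe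
  have hmem : ∀ x, InnerProductSpace.rankOne ℂ (F.dual x) (F.vec x) ∈ K := fun x => by
    have : IsCompactOperator (ContinuousLinearMap.toSpanSingleton ℂ (F.dual x)) :=
      isCompactOperator_id.clm_comp _
    exact this.comp_clm (innerSL ℂ (F.vec x))
  let φ : X → K := fun x => ⟨_, hmem x⟩
  have hφ : IntegrableOn φ s μ := by
    have hc : Continuous φ := F.continuous_rankOne_dual_vec.subtype_mk _
    exact (hc.continuousOn.integrableOn_compact hs.isCompact_closure).mono_set subset_closure
  have h := K.subtypeL.integral_comp_comm hφ
  have h' : F.truncation s = K.subtypeL (∫ x in s, φ x ∂μ) := h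
  rw [h']
  exact (∫ x in s, φ x ∂μ).2

/-! ### The remainder of a truncation -/

/-- The frame coefficients of what `T` makes of the remainder of a truncation are dominated by
the integral operator whose kernel is the matrix of `T`, off the truncated set. -/
theorem enorm_inner_apply_sub_truncation_le (F : ContinuousFrame X H μ) {s : Set X}
    (hs : Bornology.IsBounded s) (hsm : MeasurableSet s) (T : H →L[ℂ] H) (h : H) (y : X) :
    ‖inner ℂ (F.vec y) (T (h - F.truncation s h))‖ₑ
      ≤ ∫⁻ x in sᶜ, ‖inner ℂ (F.vec y) (T (F.dual x))‖ₑ * ‖inner ℂ (F.vec x) h‖ₑ ∂μ := by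
  have h1 : inner ℂ (F.vec y) (T (h - F.truncation s h))
      = ∫ x in sᶜ, inner ℂ (F.vec y) (T (F.dual x)) * inner ℂ (F.vec x) h ∂μ := by
    -- the reproducing formula is weak, so `T` is first moved to the other side
    simp_rw [← ContinuousLinearMap.adjoint_inner_left T]
    rw [inner_sub_right, F.inner_truncation hs, F.inner_eq_integral,
      ← integral_add_compl hsm (F.integrable_inner_dual_mul _ h), add_sub_cancel_left]
  rw [h1]
  refine (enorm_integral_le_lintegral_enorm _).trans_eq ?_
  simp_rw [enorm_mul]

/-- Let the matrix of `T` have Schur norm at most `a` at distance at least `R` from the diagonal,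
and entries at most `b` near the diagonal in the columns outside `s`. As balls of radius `R` have
measure at most `m`, the near part has Schur norm at most `b m` there. -/
theorem lintegral_sq_inner_apply_sub_truncation_le (F : ContinuousFrame X H μ) {s : Set X}
    (hs : Bornology.IsBounded s) (hsm : MeasurableSet s) (T : H →L[ℂ] H) {p : X → ℝ}
    (hp : Measurable p) (hp0 : ∀ x, 0 < p x) {R : ℝ} {a b m : ℝ≥0∞}
    (hm : ∀ x, μ (Metric.ball x R) ≤ m)
    (hleft : ∀ x, ∫⁻ y in (Metric.ball x R)ᶜ,
      ‖inner ℂ (F.vec y) (T (F.dual x))‖ₑ * ENNReal.ofReal (p y) ∂μ ≤ a * ENNReal.ofReal (p x))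
    (hright : ∀ y, ∫⁻ x in (Metric.ball y R)ᶜ,
      ‖inner ℂ (F.vec y) (T (F.dual x))‖ₑ * ENNReal.ofReal (p x) ∂μ ≤ a * ENNReal.ofReal (p y))
    (hnear : ∀ x ∉ s, ∀ y, dist x y < R → ‖inner ℂ (F.vec y) (T (F.dual x))‖ₑ ≤ b) (h : H) :
    ∫⁻ y, ‖inner ℂ (F.vec y) (T (h - F.truncation s h))‖ₑ ^ 2 ∂μ
      ≤ 2 * (a * a + b * m * (b * m)) * ∫⁻ x, ‖inner ℂ (F.vec x) h‖ₑ ^ 2 ∂μ := by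
  set k : X → X → ℝ≥0∞ := fun x y => ‖inner ℂ (F.vec y) (T (F.dual x))‖ₑ with hk
  set g : X → ℝ≥0∞ := fun x => ‖inner ℂ (F.vec x) h‖ₑ with hg
  have hgm : Measurable g := (F.continuous_vec.inner continuous_const).measurable.enorm
  have hkm : Measurable (Function.uncurry k) := by
    have hc : Continuous fun q : X × X => inner ℂ (F.vec q.2) (T (F.dual q.1)) :=
      (F.continuous_vec.comp continuous_snd).inner
        (T.continuous.comp (F.continuous_dual.comp continuous_fst))
    exact hc.measurable.enorm
  have hD : MeasurableSet {q : X × X | dist q.1 q.2 < R} :=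
    (isOpen_lt continuous_dist continuous_const).measurableSet
  -- the kernel is split into its parts far from and near to the diagonal
  let κ₁ : X → X → ℝ≥0∞ := fun x y =>
    {q : X × X | dist q.1 q.2 < R}ᶜ.indicator (Function.uncurry k) (x, y)
  let κ₂ : X → X → ℝ≥0∞ := fun x y => {q : X × X | dist q.1 q.2 < R}.indicator (fun _ => b) (x, y)
  have hκ₁ : Measurable (Function.uncurry κ₁) := hkm.indicator hD.compl
  have hκ₂ : Measurable (Function.uncurry κ₂) := measurable_const.indicator hD
  have hp' : Measurable fun x => ENNReal.ofReal (p x) := hp.ennreal_ofReal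
  have h1 : ∫⁻ y, (∫⁻ x, κ₁ x y * g x ∂μ) ^ 2 ∂μ ≤ a * a * ∫⁻ x, g x ^ 2 ∂μ := by
    refine lintegral_sq_lintegral_le_of_schur hκ₁ hp' hgm (fun x => by simpa using hp0 x)
      (fun x => ENNReal.ofReal_ne_top) (fun x => (hleft x).trans' ?_) fun y => (hright y).trans' ?_
    · rw [← lintegral_indicator Metric.isOpen_ball.measurableSet.compl]
      refine lintegral_mono fun y => ?_
      by_cases hxy : dist x y < R <;> simp [κ₁, hxy, dist_comm y x, hk]
    · rw [← lintegral_indicator Metric.isOpen_ball.measurableSet.compl]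
      refine lintegral_mono fun x => ?_
      by_cases hxy : dist x y < R <;> simp [κ₁, hxy, hk]
  have h2 : ∫⁻ y, (∫⁻ x, κ₂ x y * g x ∂μ) ^ 2 ∂μ ≤ b * m * (b * m) * ∫⁻ x, g x ^ 2 ∂μ := by
    have hball : ∀ x, ∫⁻ y in Metric.ball x R, b ∂μ ≤ b * m * 1 := fun x => by
      rw [setLIntegral_const, mul_one]
      gcongr
      exact hm x
    refine lintegral_sq_lintegral_le_of_schur hκ₂ (p := fun _ => 1) measurable_const hgm
      (fun _ => one_ne_zero) (fun _ => ENNReal.one_ne_top) (fun x => (hball x).trans' ?_)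
      fun y => (hball y).trans' ?_
    · rw [← lintegral_indicator Metric.isOpen_ball.measurableSet]
      refine lintegral_mono fun y => ?_
      by_cases hxy : dist x y < R <;> simp [κ₂, hxy, dist_comm y x]
    · rw [← lintegral_indicator Metric.isOpen_ball.measurableSet]
      refine lintegral_mono fun x => ?_
      by_cases hxy : dist x y < R <;> simp [κ₂, hxy]
  have hκg₁ : Measurable fun q : X × X => κ₁ q.2 q.1 * g q.2 :=
    (hκ₁.comp measurable_swap).mul (hgm.comp measurable_snd)
  have hpoint : ∀ y, ‖inner ℂ (F.vec y) (T (h - F.truncation s h))‖ₑ ^ 2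
      ≤ 2 * ((∫⁻ x, κ₁ x y * g x ∂μ) ^ 2 + (∫⁻ x, κ₂ x y * g x ∂μ) ^ 2) := by
    intro y
    have hle : ‖inner ℂ (F.vec y) (T (h - F.truncation s h))‖ₑ
        ≤ (∫⁻ x, κ₁ x y * g x ∂μ) + ∫⁻ x, κ₂ x y * g x ∂μ := by
      refine (F.enorm_inner_apply_sub_truncation_le hs hsm T h y).trans ?_
      have hκg : Measurable fun x => κ₁ x y * g x := hκg₁.comp measurable_prodMk_left
      rw [← lintegral_add_left hκg, ← lintegral_indicator hsm.compl]
      refine lintegral_mono fun x => ?_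
      by_cases hx : x ∈ s
      · simp [hx]
      by_cases hxy : dist x y < R
      · simpa [κ₁, κ₂, hx, hxy] using mul_le_mul_left (hnear x hx y hxy) (g x)
      · simp [κ₁, κ₂, hx, hxy, hk, hg]
    exact (pow_le_pow_left' hle 2).trans (by
      simpa [show (2 : ℝ) - 1 = 1 by norm_num] using
        ENNReal.rpow_add_le_mul_rpow_add_rpow (∫⁻ x, κ₁ x y * g x ∂μ) (∫⁻ x, κ₂ x y * g x ∂μ)
          one_le_two)
  calc ∫⁻ y, ‖inner ℂ (F.vec y) (T (h - F.truncation s h))‖ₑ ^ 2 ∂μ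
      ≤ ∫⁻ y, 2 * ((∫⁻ x, κ₁ x y * g x ∂μ) ^ 2 + (∫⁻ x, κ₂ x y * g x ∂μ) ^ 2) ∂μ :=
        lintegral_mono hpoint
    _ = 2 * ((∫⁻ y, (∫⁻ x, κ₁ x y * g x ∂μ) ^ 2 ∂μ)
          + ∫⁻ y, (∫⁻ x, κ₂ x y * g x ∂μ) ^ 2 ∂μ) := by
        rw [lintegral_const_mul' _ _ (by norm_num),
          lintegral_add_left (hκg₁.lintegral_prod_right'.pow_const 2)]
    _ ≤ 2 * (a * a * (∫⁻ x, g x ^ 2 ∂μ) + b * m * (b * m) * ∫⁻ x, g x ^ 2 ∂μ) := by gcongr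
    _ = _ := by ring

end Frame

section Group

variable {G H : Type*} [Group G] [MetricSpace G] [IsTopologicalGroup G]
  [MeasurableSpace G] [BorelSpace G] {μ : Measure G} [μ.IsHaarMeasure]
  [NormedAddCommGroup H] [InnerProductSpace ℂ H] [CompleteSpace H]

/-! ### Translation operators -/

/-- Left translation by `z` on `L²`, carried to `H` by analysis and synthesis: an operator that
takes `f̃_x` to `f_{zx}` if the frame is translation invariant. -/
noncomputable def translation (F : ContinuousFrame G H μ) (z : G) : H →L[ℂ] H :=
  F.synthesis ∘L (Lp.compMeasurePreservingₗᵢ ℂ (fun x : G => z⁻¹ * x)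
    (measurePreserving_mul_left μ z⁻¹)).toContinuousLinearMap ∘L F.analysis

theorem translation_dual (F : ContinuousFrame G H μ) (hF : F.IsTranslationInvariant) (z x : G) :
    F.translation z (F.dual x) = F.vec (z * x) := by
  have h : (Lp.compMeasurePreservingₗᵢ ℂ (fun x : G => z⁻¹ * x)
      (measurePreserving_mul_left μ z⁻¹)) (F.analysis (F.dual x))
      = F.analysis (F.dual (z * x)) := by
    refine (Lp.toLp_compMeasurePreserving (F.memLp_coeff (F.dual x))
      (measurePreserving_mul_left μ z⁻¹)).trans (MemLp.toLp_congr _ (F.memLp_coeff _) ?_)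
    refine Eventually.of_forall fun y => ?_
    simpa using hF x (z⁻¹ * y) z
  rw [← F.frameOperator_dual]
  exact congrArg F.synthesis h

theorem norm_translation_le (F : ContinuousFrame G H μ) (z : G) :
    ‖F.translation z‖ ≤ ‖F.synthesis‖ * ‖F.analysis‖ := by
  refine ContinuousLinearMap.opNorm_le_bound _ (by positivity) fun h => ?_
  refine (F.synthesis.le_opNorm _).trans ?_
  rw [mul_assoc]
  gcongr
  exact ((Lp.compMeasurePreservingₗᵢ ℂ (fun x : G => z⁻¹ * x)
    (measurePreserving_mul_left μ z⁻¹)).norm_map _).trans_le (F.analysis.le_opNorm h)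

theorem translation_inverse_vec (F : ContinuousFrame G H μ) (hF : F.IsTranslationInvariant)
    (z x : G) : F.translation z (Ring.inverse F.frameOperator (F.vec x)) = F.vec (z * x) :=
  F.translation_dual hF z x

theorem inverse_translation_dual (F : ContinuousFrame G H μ) (hF : F.IsTranslationInvariant)
    (z x : G) : Ring.inverse F.frameOperator (F.translation z (F.dual x)) = F.dual (z * x) := by
  rw [F.translation_dual hF, dual]

/-- Translates of an operator: they are uniformly bounded, and their matrices are the translates of
the matrix of `T`. -/
theorem exists_translates (F : ContinuousFrame G H μ) (hF : F.IsTranslationInvariant)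
    (T : H →L[ℂ] H) : ∃ (A : G → H →L[ℂ] H) (M : ℝ), (∀ z, ‖A z‖ ≤ M) ∧ ∀ x y z,
      inner ℂ (F.vec y) (A z (F.dual x)) = inner ℂ (F.vec (z * y)) (T (F.dual (z * x))) := by
  set N : H →L[ℂ] H := Ring.inverse F.frameOperator
  set L : ℝ := ‖F.synthesis‖ * ‖F.analysis‖
  refine ⟨fun z => ContinuousLinearMap.adjoint (F.translation z ∘L N) ∘L T ∘L N ∘L F.translation z,
    L * ‖N‖ * (‖T‖ * (‖N‖ * L)), fun z => ?_, fun x y z => ?_⟩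
  · have hL := F.norm_translation_le z
    refine (ContinuousLinearMap.opNorm_comp_le _ _).trans ?_
    gcongr
    · rw [LinearIsometryEquiv.norm_map]
      exact (ContinuousLinearMap.opNorm_comp_le _ _).trans (by gcongr)
    · refine (ContinuousLinearMap.opNorm_comp_le _ _).trans ?_
      gcongr
      exact (ContinuousLinearMap.opNorm_comp_le _ _).trans (by gcongr)
  · simp only [ContinuousLinearMap.comp_apply, ContinuousLinearMap.adjoint_inner_right]
    rw [F.inverse_translation_dual hF, F.translation_inverse_vec hF]

/-! ### Decay of the frame at infinity -/

theorem measure_ball_eq (hd : ∀ x y z : G, dist (z * x) (z * y) = dist x y) (μ : Measure G)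
    [μ.IsHaarMeasure] (x : G) (r : ℝ) : μ (Metric.ball x r) = μ (Metric.ball 1 r) := by
  rw [← measure_preimage_mul μ x⁻¹ (Metric.ball 1 r)]
  congr 1
  ext y
  rw [Set.mem_preimage, Metric.mem_ball, Metric.mem_ball, ← hd (x⁻¹ * y) 1 x, mul_inv_cancel_left,
    mul_one]

variable [ProperSpace G]

/-- The frame vectors tend weakly to `0` at infinity: the frame coefficients of a vector are
square integrable, and they vary slowly, uniformly over the group. -/
theorem tendsto_inner_vec (F : ContinuousFrame G H μ)
    (hd : ∀ x y z : G, dist (z * x) (z * y) = dist x y) (hF : F.IsTranslationInvariant) (h : H) :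
    Tendsto (fun x => inner ℂ (F.vec x) h) (comap (fun x : G => dist x 1) atTop) (𝓝 0) := by
  rw [Metric.tendsto_nhds]
  intro ε hε
  set M : ℝ := ‖F.synthesis‖ * ‖F.analysis‖ * ‖Ring.inverse F.frameOperator‖
  have hM : 0 ≤ M := by positivity
  have hclose : ∀ x w, ‖F.vec (x * w) - F.vec x‖ ≤ M * ‖F.vec w - F.vec 1‖ := fun x w => by
    conv_lhs => rw [← mul_one x, mul_assoc, one_mul]
    rw [← F.translation_inverse_vec hF x w, ← F.translation_inverse_vec hF x 1, ← map_sub,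
      ← map_sub]
    refine ((F.translation x).le_opNorm _).trans ?_
    rw [mul_assoc]
    gcongr
    · exact F.norm_translation_le x
    · exact (Ring.inverse F.frameOperator).le_opNorm _
  obtain ⟨δ, hδ0, hδ⟩ := Metric.continuousAt_iff.1 (F.continuous_vec.continuousAt (x := (1 : G)))
    (ε / 2 / (M * ‖h‖ + 1)) (by positivity)
  have hnear : ∀ x y, dist y x < δ → ‖inner ℂ (F.vec x) h‖ ≤ ‖inner ℂ (F.vec y) h‖ + ε / 2 := by
    intro x y hxy
    have h1 : dist (x⁻¹ * y) 1 < δ := by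
      rwa [← hd _ _ x, mul_inv_cancel_left, mul_one]
    have h2 := hclose x (x⁻¹ * y)
    rw [mul_inv_cancel_left] at h2
    have h3 := hδ h1
    rw [dist_eq_norm] at h3
    have h4 : ‖inner ℂ (F.vec y - F.vec x) h‖ ≤ ε / 2 := by
      calc ‖inner ℂ (F.vec y - F.vec x) h‖ ≤ ‖F.vec y - F.vec x‖ * ‖h‖ := norm_inner_le_norm _ _
        _ ≤ M * (ε / 2 / (M * ‖h‖ + 1)) * ‖h‖ := by
          gcongr
          exact h2.trans (by gcongr)
        _ = (M * ‖h‖) / (M * ‖h‖ + 1) * (ε / 2) := by ring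
        _ ≤ 1 * (ε / 2) := by
          gcongr
          exact div_le_one_of_le₀ (by linarith) (by positivity)
        _ = ε / 2 := one_mul _
    rw [inner_sub_left] at h4
    linarith [norm_sub_norm_le (inner ℂ (F.vec x) h) (inner ℂ (F.vec y) h),
      norm_sub_rev (inner ℂ (F.vec x) h) (inner ℂ (F.vec y) h)]
  have hint : Integrable (fun x => ‖inner ℂ (F.vec x) h‖ ^ 2) μ :=
    (memLp_two_iff_integrable_sq_norm (F.memLp_coeff h).1).1 (F.memLp_coeff h)
  have htail : Tendsto (fun r : ℝ => ∫ x in (Metric.ball 1 r)ᶜ, ‖inner ℂ (F.vec x) h‖ ^ 2 ∂μ)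
      atTop (𝓝 0) := by
    have h0 : ⋂ r : ℝ, (Metric.ball (1 : G) r)ᶜ = ∅ := by
      ext x
      simpa using ⟨dist x 1 + 1, by linarith⟩
    have h1 := tendsto_setIntegral_of_antitone (μ := μ)
      (f := fun x => ‖inner ℂ (F.vec x) h‖ ^ 2) (s := fun r : ℝ => (Metric.ball (1 : G) r)ᶜ)
      (fun r => Metric.isOpen_ball.measurableSet.compl)
      (fun r r' hr => Set.compl_subset_compl.2 (Metric.ball_subset_ball hr)) ⟨0, hint.integrableOn⟩
    rwa [h0, Measure.restrict_empty, integral_zero_measure] at h1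
  have hfin : μ (Metric.ball (1 : G) δ) ≠ ∞ := Metric.isBounded_ball.measure_lt_top.ne
  have hv : 0 < μ.real (Metric.ball (1 : G) δ) :=
    ENNReal.toReal_pos (Metric.measure_ball_pos μ 1 hδ0).ne' hfin
  -- a coefficient of size `ε` at a remote point `x` is felt on the ball of radius `δ` about `x`,
  -- whose measure does not depend on `x`
  obtain ⟨r, hr⟩ := (htail.eventually (gt_mem_nhds
    (show 0 < (ε / 2) ^ 2 * μ.real (Metric.ball (1 : G) δ) by positivity))).exists
  refine mem_comap.2 ⟨Set.Ici (r + δ), Ici_mem_atTop _, fun x hx => ?_⟩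
  have hx' : r + δ ≤ dist x 1 := hx
  change dist (inner ℂ (F.vec x) h) 0 < ε
  rw [dist_zero_right]
  by_contra! hge
  have hsub : Metric.ball x δ ⊆ (Metric.ball (1 : G) r)ᶜ := fun y hy hy' => by
    rw [Metric.mem_ball] at hy hy'
    linarith [dist_triangle_left x 1 y]
  have h1 : (ε / 2) ^ 2 * μ.real (Metric.ball (1 : G) δ)
      ≤ ∫ y in Metric.ball x δ, ‖inner ℂ (F.vec y) h‖ ^ 2 ∂μ := by
    rw [Measure.real, ← measure_ball_eq hd μ x δ]
    refine setIntegral_ge_of_const_le_real Metric.isOpen_ball.measurableSet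
      (by rwa [measure_ball_eq hd]) (fun y hy => ?_) hint.integrableOn
    have := hnear x y hy
    gcongr
    linarith
  have h2 := setIntegral_mono_set (hint.integrableOn (s := (Metric.ball (1 : G) r)ᶜ))
    (Eventually.of_forall fun y => by positivity) (LE.le.eventuallyLE hsub)
  linarith

/-- The Berezin transform of a compact operator vanishes at infinity: along an ultrafilter at
infinity `T f̃_x` has a norm limit by compactness, while `f_x` tends weakly to `0`. -/
theorem tendsto_berezin_of_isCompactOperator (F : ContinuousFrame G H μ)
    (hd : ∀ x y z : G, dist (z * x) (z * y) = dist x y) (hF : F.IsTranslationInvariant)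
    {T : H →L[ℂ] H} (hT : IsCompactOperator T) :
    Tendsto (F.berezin T) (comap (fun x : G => dist x 1) atTop) (𝓝 0) := by
  obtain ⟨M, hM⟩ := F.bounded_vec
  obtain ⟨M', hM'⟩ := F.bounded_dual
  obtain ⟨K, hK, hTK⟩ := hT.image_subset_compact_of_bounded (f := (T : H →ₗ[ℂ] H))
    (isBounded_iff_forall_norm_le.2 ⟨M', by rintro _ ⟨x, rfl⟩; exact hM' x⟩ :
      Bornology.IsBounded (Set.range F.dual))
  rw [tendsto_iff_ultrafilter]
  intro 𝒰 h𝒰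
  obtain ⟨k, -, hk⟩ := hK.ultrafilter_le_nhds (𝒰.map fun x => T (F.dual x))
    (le_principal_iff.2 (Filter.mem_map.2 (Eventually.of_forall fun x =>
      hTK ⟨_, ⟨x, rfl⟩, rfl⟩)))
  have hk' : Tendsto (fun x => T (F.dual x)) 𝒰 (𝓝 k) := hk
  have h1 : Tendsto (fun x => inner ℂ (F.vec x) k) 𝒰 (𝓝 0) :=
    (F.tendsto_inner_vec hd hF k).mono_left h𝒰
  have h2 : Tendsto (fun x => inner ℂ (F.vec x) (T (F.dual x) - k)) 𝒰 (𝓝 0) := by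
    refine squeeze_zero_norm (fun x => (norm_inner_le_norm _ _).trans
      (mul_le_mul_of_nonneg_right (hM x) (norm_nonneg _))) ?_
    simpa using (tendsto_iff_norm_sub_tendsto_zero.1 hk').const_mul M
  refine Tendsto.congr (fun x => ?_) (by simpa only [add_zero] using h1.add h2)
  change _ = inner ℂ (F.vec x) (T (F.dual x))
  rw [inner_sub_right, add_sub_cancel]

/-! ### Vanishing near the diagonal, and compactness -/

/-- If the Berezin transform of `T` vanishes at infinity, then so does the matrix of `T` in every
neighbourhood of the diagonal. Otherwise the translates of `T` would have a nonzero weak limit,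
whose Berezin transform is zero. -/
theorem exists_norm_matrix_le (F : ContinuousFrame G H μ)
    (hd : ∀ x y z : G, dist (z * x) (z * y) = dist x y) (hF : F.IsTranslationInvariant)
    (hinj : Function.Injective F.berezin) {T : H →L[ℂ] H}
    (hT : Tendsto (F.berezin T) (comap (fun x : G => dist x 1) atTop) (𝓝 0)) (R : ℝ) {ε : ℝ}
    (hε : 0 < ε) : ∃ ρ : ℝ, ∀ x, ρ ≤ dist x 1 → ∀ y, dist x y < R →
      ‖inner ℂ (F.vec y) (T (F.dual x))‖ ≤ ε := by
  set l : Filter G := comap (fun x : G => dist x 1) atTop with hl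
  by_contra! hcon
  have hfreq : ∃ᶠ x in l, ∃ y, dist x y < R ∧ ε < ‖inner ℂ (F.vec y) (T (F.dual x))‖ := by
    rw [hl, frequently_comap, frequently_atTop]
    intro ρ
    obtain ⟨x, hx, y, hy⟩ := hcon ρ
    exact ⟨_, hx, x, rfl, y, hy⟩
  have : (l ⊓ 𝓟 {x | ∃ y, dist x y < R ∧ ε < ‖inner ℂ (F.vec y) (T (F.dual x))‖}).NeBot :=
    frequently_mem_iff_neBot.1 hfreq
  obtain ⟨𝒰, h𝒰⟩ := Ultrafilter.exists_le
    (l ⊓ 𝓟 {x | ∃ y, dist x y < R ∧ ε < ‖inner ℂ (F.vec y) (T (F.dual x))‖})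
  have h𝒰l : (𝒰 : Filter G) ≤ l := h𝒰.trans inf_le_left
  have hev : ∀ᶠ x in 𝒰, ∃ w, dist w 1 < R ∧ ε < ‖inner ℂ (F.vec (x * w)) (T (F.dual x))‖ := by
    filter_upwards [h𝒰.trans inf_le_right (mem_principal_self _)] with x hx
    obtain ⟨y, hy1, hy2⟩ := hx
    refine ⟨x⁻¹ * y, ?_, by rwa [mul_inv_cancel_left]⟩
    rwa [← hd _ _ x, mul_inv_cancel_left, mul_one, dist_comm]
  obtain ⟨w, hw⟩ := hev.choice
  obtain ⟨w₀, -, hw₀⟩ := (isCompact_closedBall (1 : G) R).ultrafilter_le_nhds (𝒰.map w)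
    (le_principal_iff.2 (Filter.mem_map.2 (hw.mono fun x hx => Metric.mem_closedBall.2 hx.1.le)))
  have hw₀' : Tendsto w 𝒰 (𝓝 w₀) := hw₀
  -- the translate of `T` by `x` has the entry `k(x, y)` at `(1, w)`, and `w = x⁻¹ y` stays
  -- bounded
  obtain ⟨A, M, hM, hA⟩ := F.exists_translates hF T
  obtain ⟨A₀, hA₀⟩ := exists_weak_operator_limit 𝒰 hM
  -- right translation moves points by a bounded distance, so `B(A₀)(a) = lim B(T)(x a) = 0`
  have hzero : A₀ = 0 := by
    refine hinj (ContinuousMap.ext fun a => ?_)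
    have h1 : Tendsto (fun x => x * a) 𝒰 l := by
      refine Tendsto.mono_left ?_ h𝒰l
      rw [hl, tendsto_comap_iff]
      refine tendsto_atTop_mono (fun x => ?_) (tendsto_atTop_add_const_right _ (-dist a 1)
        (tendsto_comap (f := fun x : G => dist x 1)))
      have h2 := dist_triangle x (x * a) 1
      have h3 : dist x (x * a) = dist a 1 := by
        conv_lhs => rw [← mul_one x, mul_assoc, one_mul, hd, dist_comm]
      simp only [Function.comp_apply]
      linarith
    have h2 : F.berezin A₀ a = 0 :=
      tendsto_nhds_unique (hA₀ (F.vec a) (F.dual a)) ((hT.comp h1).congr fun x => (hA a a x).symm)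
    rw [h2]
    simp [berezin]
  obtain ⟨M', hM'⟩ := F.bounded_dual
  have hsum : Tendsto (fun x => inner ℂ (F.vec w₀) (A x (F.dual 1))
      + inner ℂ (F.vec (w x) - F.vec w₀) (A x (F.dual 1))) 𝒰 (𝓝 (0 + 0)) := by
    refine Tendsto.add (by simpa [hzero] using hA₀ (F.vec w₀) (F.dual 1)) ?_
    refine squeeze_zero_norm (fun x => (norm_inner_le_norm _ _).trans
      (mul_le_mul_of_nonneg_left (((A x).le_opNorm _).trans
        (mul_le_mul_of_nonneg_right (hM x) (norm_nonneg _))) (norm_nonneg _))) ?_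
    simpa using (tendsto_iff_norm_sub_tendsto_zero.1
      ((F.continuous_vec.tendsto w₀).comp hw₀')).mul_const (M * ‖F.dual 1‖)
  rw [add_zero] at hsum
  obtain ⟨x, hx1, hx2⟩ := ((Metric.tendsto_nhds.1 hsum ε hε).and hw).exists
  rw [dist_zero_right, inner_sub_left, add_sub_cancel, hA, mul_one] at hx1
  exact lt_asymm hx1 hx2.2

/-- A weakly localized operator whose Berezin transform vanishes at infinity is the norm limit of
its compositions with the truncations to balls, and hence compact. -/
theorem isCompactOperator_of_tendsto_berezin (F : ContinuousFrame G H μ)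
    (hd : ∀ x y z : G, dist (z * x) (z * y) = dist x y) (hF : F.IsTranslationInvariant)
    (hinj : Function.Injective F.berezin) {T : H →L[ℂ] H}
    (hloc : IsWeaklyLocalizedOperator μ F.dual F.vec T)
    (hT : Tendsto (F.berezin T) (comap (fun x : G => dist x 1) atTop) (𝓝 0)) :
    IsCompactOperator T := by
  obtain ⟨p, hpm, hp0, hp⟩ := hloc
  obtain ⟨c, hc0, hc⟩ := F.lower_bound
  obtain ⟨C, hC0, hC⟩ := F.upper_bound
  have hclosed : IsClosed {A : H →L[ℂ] H | IsCompactOperator A} :=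
    isClosed_setOfPred_isCompactOperator
  suffices h : T ∈ closure {A : H →L[ℂ] H | IsCompactOperator A} by
    rwa [hclosed.closure_eq] at h
  refine Metric.mem_closure_iff.2 fun ε hε => ?_
  -- chosen so that `4 θ² C = c (ε / 2)²`
  obtain ⟨θ, hθ⟩ : ∃ θ : ℝ, θ = ε / 4 * √(c / C) := ⟨_, rfl⟩
  have hθ0 : 0 < θ := hθ ▸ by positivity
  have hθ2 : 4 * θ ^ 2 * C = c * (ε / 2) ^ 2 := by
    rw [hθ, mul_pow, Real.sq_sqrt (by positivity)]
    field_simp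
    norm_num
  have hθ' : (0 : ℝ≥0∞) < ENNReal.ofReal θ := ENNReal.ofReal_pos.2 hθ0
  have htail : ∀ {u : G → ℝ≥0∞}, (⨆ x, u x / ENNReal.ofReal (p x)) < ENNReal.ofReal θ →
      ∀ x, u x ≤ ENNReal.ofReal θ * ENNReal.ofReal (p x) := fun {u} hu x =>
    (ENNReal.div_le_iff (ENNReal.ofReal_pos.2 (hp0 x)).ne' ENNReal.ofReal_ne_top).1
      ((le_iSup (fun x => u x / ENNReal.ofReal (p x)) x).trans hu.le)
  obtain ⟨R, hR1, hR2⟩ := ((hp.tail_left.eventually (gt_mem_nhds hθ')).and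
    (hp.tail_right.eventually (gt_mem_nhds hθ'))).exists
  have hm : μ (Metric.ball (1 : G) R) ≠ ∞ := Metric.isBounded_ball.measure_lt_top.ne
  set m : ℝ := μ.real (Metric.ball (1 : G) R)
  have hm0 : 0 ≤ m := measureReal_nonneg
  obtain ⟨ρ, hρ⟩ := F.exists_norm_matrix_le hd hF hinj hT R (ε := θ / (m + 1)) (by positivity)
  have hbm : ENNReal.ofReal (θ / (m + 1)) * μ (Metric.ball (1 : G) R) ≤ ENNReal.ofReal θ := by
    rw [← ENNReal.ofReal_toReal hm, ← ENNReal.ofReal_mul (by positivity)]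
    refine ENNReal.ofReal_le_ofReal ?_
    calc θ / (m + 1) * m = θ * (m / (m + 1)) := by ring
      _ ≤ θ * 1 := by
        gcongr
        exact div_le_one_of_le₀ (by linarith) (by positivity)
      _ = θ := mul_one θ
  set P : H →L[ℂ] H := F.truncation (Metric.closedBall 1 ρ)
  refine ⟨T ∘L P, (F.isCompactOperator_truncation Metric.isBounded_closedBall).clm_comp T, ?_⟩
  rw [dist_eq_norm]
  refine (ContinuousLinearMap.opNorm_le_bound _ (by positivity : 0 ≤ ε / 2) fun h => ?_).trans_lt
    (half_lt_self hε)
  have hu : (T - T ∘L P) h = T (h - P h) := by simp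
  rw [hu]
  have key := F.lintegral_sq_inner_apply_sub_truncation_le (s := Metric.closedBall 1 ρ)
    Metric.isBounded_closedBall Metric.isClosed_closedBall.measurableSet T hpm hp0
    (fun x => (measure_ball_eq hd μ x R).le) (htail hR1) (htail hR2)
    (b := ENNReal.ofReal (θ / (m + 1)))
    (fun x hx y hxy => by
      rw [← ofReal_norm]
      exact ENNReal.ofReal_le_ofReal (hρ x (not_le.1 hx).le y hxy)) h
  have h1 : ENNReal.ofReal (c * ‖T (h - P h)‖ ^ 2) ≤ ENNReal.ofReal (c * (ε / 2 * ‖h‖) ^ 2) :=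
    calc ENNReal.ofReal (c * ‖T (h - P h)‖ ^ 2)
        ≤ 2 * (ENNReal.ofReal θ * ENNReal.ofReal θ + ENNReal.ofReal θ * ENNReal.ofReal θ)
            * ENNReal.ofReal (C * ‖h‖ ^ 2) :=
          (hc _).trans (key.trans (by gcongr; exact hC h))
      _ = ENNReal.ofReal (4 * θ ^ 2 * C * ‖h‖ ^ 2) := by
          rw [← two_mul, ← mul_assoc, mul_assoc (4 * θ ^ 2),
            ENNReal.ofReal_mul (q := C * ‖h‖ ^ 2) (by positivity),
            ENNReal.ofReal_mul (p := 4) (by norm_num), ENNReal.ofReal_pow hθ0.le,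
            sq (ENNReal.ofReal θ)]
          norm_num
      _ = _ := by rw [hθ2, mul_pow, mul_assoc]
  rw [ENNReal.ofReal_le_ofReal_iff (by positivity)] at h1
  exact le_of_sq_le_sq (le_of_mul_le_mul_left h1 hc0) (by positivity)

end Group

end ContinuousFrame

theorem theorem5p1 {G H : Type*} [Group G] [MetricSpace G] [IsTopologicalGroup G] [ProperSpace G]
    [MeasurableSpace G] [BorelSpace G]
    (dist_left_invariant : ∀ x y z : G, dist (z * x) (z * y) = dist x y)
    (geodesic : IsGeodesicSpace G)
    (finite_asymptotic_dimension : HasFiniteAsymptoticDimension G)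
    (μ : Measure G) [μ.IsHaarMeasure]
    [NormedAddCommGroup H] [InnerProductSpace ℂ H] [CompleteSpace H]
    [TopologicalSpace.SeparableSpace H]
    (F : ContinuousFrame G H μ)
    (inner_invariant : F.IsTranslationInvariant)
    (berezin_injective : Function.Injective F.berezin)
    (T : H →L[ℂ] H)
    (weakly_localized : IsWeaklyLocalizedOperator μ F.dual F.vec T) :
    IsCompactOperator T ↔
      Tendsto (F.berezin T) (comap (fun x : G => dist x 1) atTop) (𝓝 0) :=
  ⟨F.tendsto_berezin_of_isCompactOperator dist_left_invariant inner_invariant,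
    F.isCompactOperator_of_tendsto_berezin dist_left_invariant inner_invariant berezin_injective
      weakly_localized⟩
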